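/- Let $G=(V,E)$ be a finite undirected graph (parallel edges allowed) with edge costs $c_e\ge 0$. A biset is a pair $\mathbb A=(A,A^+)$ with $A\subseteq A^+\subseteq V$; write $A^*=V\setminus A^+$. Put $\mathbb A\cap\mathbb B=(A\cap B,A^+\cap B^+)$ and $\mathbb A\cup\mathbb B=(A\cup B,A^+\cup B^+)$. An undirected edge covers $\mathbb A$ if it has one end in $A$ and the other in $A^*$; an arc covers $\mathbb A$ if its tail is in $A$ and its head is in $A^*$. For a set $J$ of edges (or of arcs) let $\delta_J(\mathbb A)$ be the set of members of $J$ that cover $\mathbb A$; $J$ covers an integer-valued biset function $g$ if $|\delta_J(\mathbb A)|\ge g(\mathbb A)$ for all bisets $\mathbb A$. The function $g$ is positively intersecting supermodular if $g(\mathbb A\cap\mathbb B)+g(\mathbb A\cup\mathbb B)\ge g(\mathbb A)+g(\mathbb B)$ whenever $g(\mathbb A)>0$, $g(\mathbb B)>0$ and $A\cap B\ne\emptyset$. A vector $x\in[0,1]^E$ is a feasible Biset-LP solution for $g$ if $\sum_{e\in\delta_E(\mathbb A)}x_e\ge g(\mathbb A)$ for all bisets $\mathbb A$. For $S\subseteq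 V$ let $\delta(S)$ be the set of edges with exactly one end in $S$ and $\gamma(S)$ the set of edges with both ends in $S$. Let $f$ be an integer-valued biset function on $V$ with $\max_{\mathbb A}f(\mathbb A)\ge 0$, let $R\subseteq V$, and let $f_R(\mathbb A)=f(\mathbb A)-\max_{\mathbb B}f(\mathbb B)\cdot|A\cap R|$ be the area function of $f$. The algorithm Area-Cover replaces every edge of $\gamma(V\setminus R)$ by its two orientations, directs every edge of $\delta(R)$ into $R$, drops the edges of $\gamma(R)$, computes a minimum-cost set $I'$ of the resulting arcs that covers $f_R$ (each arc has the cost of its edge), and returns the set $I$ of the underlying undirected edges of $I'$. Suppose that $f_R$ is positively intersecting supermodular and that $x$ is a feasible Biset-LP solution for $f_R$. Then a directed cover $I'$ as required by the algorithm exists, and, whichever optimal $I'$ is chosen, the returned set $I$ is an $f_R$-cover with $$c(I)=\sum_{e\in I}c_e\ \le\ \sum_{e\in\delta(R)}c_ex_e+2\sum_{e\in\gamma(V\setminus R)}c_ex_e .$$ -/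

import Mathlib

/-- A biset on the ground set `V`: an ordered pair of node sets `inner ⊆ outer`. -/
@[ext]
structure Biset (V : Type*) where
  inner : Finset V
  outer : Finset V
  subset : inner ⊆ outer

namespace Biset

/-- `A ∩ B = (A ∩ B, A⁺ ∩ B⁺)`. -/
instance {V : Type*} [DecidableEq V] : Inter (Biset V) :=
  ⟨fun A B => ⟨A.inner ∩ B.inner, A.outer ∩ B.outer, Finset.inter_subset_inter A.subset B.subset⟩⟩

/-- `A ∪ B = (A ∪ B, A⁺ ∪ B⁺)`. -/
instance {V : Type*} [DecidableEq V] : Union (Biset V) :=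
  ⟨fun A B => ⟨A.inner ∪ B.inner, A.outer ∪ B.outer, Finset.union_subset_union A.subset B.subset⟩⟩

instance {V : Type*} : Inhabited (Biset V) := ⟨⟨∅, ∅, Finset.Subset.refl _⟩⟩

instance {V : Type*} [Finite V] : Finite (Biset V) :=
  Finite.of_injective (fun A : Biset V => (A.inner, A.outer)) fun _ _ h =>
    Biset.ext (congrArg Prod.fst h) (congrArg Prod.snd h)

/-- Two bisets intersect if their inner parts have a common node. -/
def Intersect {V : Type*} [DecidableEq V] (A B : Biset V) : Prop :=
  (A.inner ∩ B.inner).Nonempty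

/-- A biset function is positively intersecting supermodular if the supermodular inequality
holds for every pair of intersecting bisets on which it is positive. -/
def PositivelyIntersectingSupermodular {V : Type*} [DecidableEq V] (f : Biset V → ℤ) : Prop :=
  ∀ A B : Biset V, 0 < f A → 0 < f B → A.Intersect B → f A + f B ≤ f (A ∩ B) + f (A ∪ B)

/-- The maximum value of a biset function. -/
noncomputable def maxValue {V : Type*} (f : Biset V → ℤ) : ℤ := ⨆ A, f A

theorem isGreatest_maxValue {V : Type*} [Finite V] (f : Biset V → ℤ) :
    IsGreatest (Set.range f) (maxValue f) :=
  ⟨(Set.range_nonempty f).csSup_mem (Set.finite_range f),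
    fun _ h => le_csSup (Set.finite_range f).bddAbove h⟩

/-- The area function `f_R(A) = f(A) - (max f) * |A ∩ R|`. -/
noncomputable def area {V : Type*} [DecidableEq V] (f : Biset V → ℤ) (R : Finset V) :
    Biset V → ℤ :=
  fun A => f A - maxValue f * ((A.inner ∩ R).card : ℤ)

end Biset

/-- An undirected graph with node set `V` and edge set `E`, parallel edges being allowed:
every edge has an unordered pair of ends. -/
structure UGraph (V E : Type*) where
  ends : E → Sym2 V

/-- An arc: an edge name together with a tail and a head. -/
structure Arc (V E : Type*) where
  edge : E
  tail : V
  head : V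
deriving DecidableEq

/-- An arc covers a biset `A` if it goes from `A` to `A* = V ∖ A⁺`. -/
def Arc.Covers {V E : Type*} (a : Arc V E) (A : Biset V) : Prop :=
  a.tail ∈ A.inner ∧ a.head ∉ A.outer

open Classical in
/-- The arcs of a set `J` of arcs cover the biset function `f`. -/
def IsDirectedCover {V E : Type*} (f : Biset V → ℤ) (J : Finset (Arc V E)) : Prop :=
  ∀ A : Biset V, f A ≤ ((J.filter fun a => a.Covers A).card : ℤ)

/-- The cost of a set of arcs, every arc having the cost of its underlying edge. -/
def arcCost {V E : Type*} (c : E → ℝ) (J : Finset (Arc V E)) : ℝ := ∑ a ∈ J, c a.edge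

/-- `J` is a minimum cost cover of `f` by arcs from `D`. -/
def IsOptimalDirectedCover {V E : Type*} (D : Set (Arc V E)) (c : E → ℝ)
    (f : Biset V → ℤ) (J : Finset (Arc V E)) : Prop :=
  ((J : Set (Arc V E)) ⊆ D ∧ IsDirectedCover f J) ∧
    ∀ K : Finset (Arc V E), (K : Set (Arc V E)) ⊆ D → IsDirectedCover f K →
      arcCost c J ≤ arcCost c K

namespace UGraph

/-- The undirected edge `e` covers `A` if it has one end in `A` and the other in
`A* = V ∖ A⁺`. -/
def Covers {V E : Type*} (G : UGraph V E) (e : E) (A : Biset V) : Prop :=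
  ∃ u ∈ A.inner, ∃ v ∉ A.outer, G.ends e = s(u, v)

open Classical in
/-- The set `δ_J(A)` of the edges in `J` that cover the biset `A`. -/
noncomputable def bisetCut {V E : Type*} (G : UGraph V E) (J : Finset E) (A : Biset V) :
    Finset E :=
  J.filter fun e => G.Covers e A

/-- `J` covers the biset function `f`. -/
def IsCover {V E : Type*} (G : UGraph V E) (f : Biset V → ℤ) (J : Finset E) : Prop :=
  ∀ A : Biset V, f A ≤ ((G.bisetCut J A).card : ℤ)

/-- `x` is a feasible solution of the Biset-LP for `f`. -/
def BisetLPFeasible {V E : Type*} [Fintype E] (G : UGraph V E) (f : Biset V → ℤ)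
    (x : E → ℝ) : Prop :=
  (∀ A : Biset V, (f A : ℝ) ≤ ∑ e ∈ G.bisetCut Finset.univ A, x e) ∧
    ∀ e, 0 ≤ x e ∧ x e ≤ 1

open Classical in
/-- `δ(S)`: the edges with exactly one end in `S`. -/
noncomputable def cut {V E : Type*} [Fintype E] (G : UGraph V E) (S : Finset V) : Finset E :=
  Finset.univ.filter fun e => ∃ u ∈ S, ∃ v ∉ S, G.ends e = s(u, v)

open Classical in
/-- `γ(S)`: the edges with both ends in `S`. -/
noncomputable def inside {V E : Type*} [Fintype E] (G : UGraph V E) (S : Finset V) : Finset E :=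
  Finset.univ.filter fun e => ∀ v ∈ G.ends e, v ∈ S

/-- The arcs of the directed graph obtained by bidirecting the edges in `γ(V ∖ R)` and directing
into `R` the edges in `δ(R)`; the edges in `γ(R)` are dropped. -/
def areaArcs {V E : Type*} [Fintype V] [DecidableEq V] [Fintype E] (G : UGraph V E)
    (R : Finset V) : Set (Arc V E) :=
  {a | G.ends a.edge = s(a.tail, a.head) ∧
    (a.edge ∈ G.inside (Finset.univ \ R) ∨ (a.edge ∈ G.cut R ∧ a.head ∈ R))}

/-- `I` is a possible output of the algorithm Area-Cover with input `G, c, f, R`: the underlying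
edge set of an optimal directed cover of the area function `f_R` in the directed graph above. -/
def IsAreaCoverOutput {V E : Type*} [Fintype V] [DecidableEq V] [Fintype E] [DecidableEq E]
    (G : UGraph V E) (c : E → ℝ) (f : Biset V → ℤ) (R : Finset V) (I : Finset E) : Prop :=
  ∃ J : Finset (Arc V E),
    IsOptimalDirectedCover (G.areaArcs R) c (Biset.area f R) J ∧ I = J.image Arc.edge

end UGraph

/-!
The proof compares the optimal directed cover with the vector that gives both orientations of an
edge the value of this edge in `x`. Since `max f ≥ 0`, the area function is positive only on
bisets whose inner part avoids `R`. Every edge that covers such a biset has an orientation in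
`G.areaArcs R` that covers it (`UGraph.exists_arc_of_covers`), so this vector is a fractional
directed cover (`UGraph.area_le_sum_arcs`). It costs at most the right-hand side of the claim,
because an edge of `δ(R)` has one arc and an edge of `γ(V ∖ R)` at most two
(`UGraph.sum_arcs_le`). Conversely, the underlying edges of a directed cover form a cover
(`UGraph.isCover_image`), at no greater cost.

What remains is that the directed covering problem has no integrality gap
(`exists_integral_mem_coverPolytope`): an extreme point `y` of the set of optimal fractional
covers is a `0`-`1` vector. Otherwise `exists_perturbation` gives a nonzero direction `z`, supported
on the fractional arcs, that has weight `0` on every tight biset, and `y` is a midpoint of two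
optimal fractional covers `y ± ε z`. To find `z`, take a maximal laminar family `L` among the tight
bisets that are covered by a fractional arc. By uncrossing (`tight_uncross`), a vector supported on
the fractional arcs that vanishes on the cuts of `L` vanishes on all tight cuts.
The cuts of `L` have a network structure: the members of `L` that an arc covers form an
interval of the chain of members through its tail, beginning with the least one. Hence the equations
`z(δ(A)) = 0` for `A ∈ L` amount to a flow conservation condition at each member of `L`, and
integrality of `y(δ(A))` shows that there are fewer nontrivial conditions than fractional arcs
(`exists_perturbation_of_laminar`).
-/

/-! ### Laminar families of bisets -/

namespace Biset

/-- The order of bisets by containment: both the inner parts and the outer parts are nested. -/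
instance {V : Type*} : PartialOrder (Biset V) :=
  PartialOrder.lift (fun A : Biset V => (A.inner, A.outer)) fun _ _ h =>
    Biset.ext (congrArg Prod.fst h) (congrArg Prod.snd h)

/-- A family of bisets is laminar if any two of its members with a common inner node are
nested. -/
def Laminar {V : Type*} [DecidableEq V] (L : Finset (Biset V)) : Prop :=
  ∀ A ∈ L, ∀ B ∈ L, A.Intersect B → A ≤ B ∨ B ≤ A

theorem intersect_of_mem {V : Type*} [DecidableEq V] {A B : Biset V} {v : V}
    (hA : v ∈ A.inner) (hB : v ∈ B.inner) : A.Intersect B :=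
  ⟨v, Finset.mem_inter.2 ⟨hA, hB⟩⟩

/-- In a laminar family, the members through a given node form a chain, so those of them that
have a given property have a least element. -/
theorem Laminar.exists_least {V : Type*} [DecidableEq V] {L : Finset (Biset V)}
    (hL : Laminar L) (v : V) (p : Biset V → Prop) {A : Biset V} (hA : A ∈ L)
    (hv : v ∈ A.inner) (hp : p A) :
    ∃ B ∈ L, v ∈ B.inner ∧ p B ∧ ∀ C ∈ L, v ∈ C.inner → p C → B ≤ C := by
  classical
  obtain ⟨B, hB⟩ := Finset.exists_minimal (s := L.filter fun C => v ∈ C.inner ∧ p C)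
    ⟨A, by simp [hA, hv, hp]⟩
  have hm := hB.prop
  simp only [Finset.mem_filter] at hm
  refine ⟨B, hm.1, hm.2.1, hm.2.2, fun C hC hvC hpC => ?_⟩
  rcases hL B hm.1 C hC (intersect_of_mem hm.2.1 hvC) with h | h
  · exact h
  · exact hB.le_of_le (by simp [hC, hvC, hpC]) h

end Biset

open Classical in
theorem sum_ite_of_unique {β : Type*} (S : Finset β) (p : β → Prop)
    (hp : ∀ b c, p b → p c → b = c) :
    ∑ b ∈ S, (if p b then (1 : ℝ) else 0) = if ∃ b ∈ S, p b then 1 else 0 := by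
  split_ifs with h
  · obtain ⟨b, hb, hpb⟩ := h
    rw [Finset.sum_eq_single b (fun c _ hc => if_neg fun hpc => hc (hp _ _ hpc hpb))
      (fun h => absurd hb h), if_pos hpb]
  · exact Finset.sum_eq_zero fun b hb => if_neg fun hpb => h ⟨b, hb, hpb⟩

namespace Arc

variable {V E : Type*}

/-- An arc that covers a biset also covers each smaller one that contains its tail. -/
theorem Covers.anti {a : Arc V E} {A B : Biset V} (h : a.Covers B) (hAB : A ≤ B)
    (ht : a.tail ∈ A.inner) : a.Covers A :=
  ⟨ht, fun hh => h.2 (hAB.2 hh)⟩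

/-- The arc `a` starts at `B` if `B` is the least member of `L` that contains the tail of `a`,
and `a` covers it. -/
def StartsAt (L : Finset (Biset V)) (a : Arc V E) (B : Biset V) : Prop :=
  B ∈ L ∧ a.Covers B ∧ ∀ C ∈ L, a.tail ∈ C.inner → B ≤ C

/-- The arc `a` ends at `B` if it covers some member of `L`, and `B` is the least member of `L`
that contains the tail of `a` without being covered by `a`. -/
def EndsAt (L : Finset (Biset V)) (a : Arc V E) (B : Biset V) : Prop :=
  (∃ C ∈ L, a.Covers C) ∧ B ∈ L ∧ a.tail ∈ B.inner ∧ ¬ a.Covers B ∧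
    ∀ C ∈ L, a.tail ∈ C.inner → ¬ a.Covers C → B ≤ C

theorem StartsAt.unique {L : Finset (Biset V)} {a : Arc V E} {B C : Biset V}
    (hB : a.StartsAt L B) (hC : a.StartsAt L C) : B = C :=
  le_antisymm (hB.2.2 C hC.1 hC.2.1.1) (hC.2.2 B hB.1 hB.2.1.1)

theorem EndsAt.unique {L : Finset (Biset V)} {a : Arc V E} {B C : Biset V}
    (hB : a.EndsAt L B) (hC : a.EndsAt L C) : B = C :=
  le_antisymm (hB.2.2.2.2 C hC.2.1 hC.2.2.1 hC.2.2.2.1)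
    (hC.2.2.2.2 B hB.2.1 hB.2.2.1 hB.2.2.2.1)

theorem exists_startsAt [DecidableEq V] {L : Finset (Biset V)} (hL : Biset.Laminar L)
    {a : Arc V E} {A : Biset V} (hA : A ∈ L) (ha : a.Covers A) :
    ∃ B, a.StartsAt L B ∧ B ≤ A := by
  obtain ⟨B, hB, hv, -, hle⟩ := hL.exists_least a.tail (fun _ => True) hA ha.1 trivial
  have hBA := hle A hA ha.1 trivial
  exact ⟨B, ⟨hB, ha.anti hBA hv, fun C hC hvC => hle C hC hvC trivial⟩, hBA⟩

theorem exists_endsAt [DecidableEq V] {L : Finset (Biset V)} (hL : Biset.Laminar L)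
    {a : Arc V E} {A C : Biset V} (hC : C ∈ L) (haC : a.Covers C) (hA : A ∈ L)
    (hv : a.tail ∈ A.inner) (ha : ¬ a.Covers A) : ∃ B, a.EndsAt L B ∧ B ≤ A := by
  obtain ⟨B, hB, hv', hn, hle⟩ := hL.exists_least a.tail (fun D => ¬ a.Covers D) hA hv ha
  exact ⟨B, ⟨⟨C, hC, haC⟩, hB, hv', hn, hle⟩, hle A hA hv ha⟩

open Classical in
/-- The incidence of an arc and a member of the laminar family: `1` where it starts, `-1` where
it ends. -/
noncomputable def incidence (L : Finset (Biset V)) (a : Arc V E) (B : Biset V) : ℝ :=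
  (if a.StartsAt L B then 1 else 0) - (if a.EndsAt L B then 1 else 0)

open Classical in
/-- An arc covers `A` exactly if it starts at some member of the family below `A` and does not
end at any such member. -/
theorem sum_incidence [DecidableEq V] {L : Finset (Biset V)} (hL : Biset.Laminar L)
    (a : Arc V E) {A : Biset V} (hA : A ∈ L) :
    ∑ B ∈ L with B ≤ A, a.incidence L B = if a.Covers A then 1 else 0 := by
  simp only [incidence, Finset.sum_sub_distrib]
  rw [sum_ite_of_unique _ _ fun _ _ => StartsAt.unique,
    sum_ite_of_unique _ _ fun _ _ => EndsAt.unique]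
  by_cases hc : a.Covers A
  · obtain ⟨B, hB, hBA⟩ := exists_startsAt hL hA hc
    rw [if_pos ⟨B, by simp [hB.1, hBA], hB⟩, if_neg, if_pos hc, sub_zero]
    rintro ⟨C, hC, hCe⟩
    exact hCe.2.2.2.1 (hc.anti (Finset.mem_filter.1 hC).2 hCe.2.2.1)
  · rw [if_neg hc, sub_eq_zero]
    refine if_congr ⟨?_, ?_⟩ rfl rfl
    · rintro ⟨B, hB, hBs⟩
      obtain ⟨C, hC, hCA⟩ := exists_endsAt hL hBs.1 hBs.2.1 hA
        ((Finset.mem_filter.1 hB).2.1 hBs.2.1.1) hc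
      exact ⟨C, by simp [hC.2.1, hCA], hC⟩
    · rintro ⟨B, hB, hBe⟩
      obtain ⟨D, hD, hDc⟩ := hBe.1
      obtain ⟨C, hC, -⟩ := exists_startsAt hL hD hDc
      exact ⟨C, by simp [hC.1, (hC.2.2 B hBe.2.1 hBe.2.2.1).trans (Finset.mem_filter.1 hB).2],
        hC⟩

end Arc

/-! ### Perturbations that vanish on a laminar family -/

open Classical in
/-- The total weight `z` of the arcs indexed by `F` that cover the biset `A`. -/
noncomputable def cutSum {V E ι : Type*} (arc : ι → Arc V E) (F : Finset ι) (z : ι → ℝ)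
    (A : Biset V) : ℝ :=
  ∑ i ∈ F, if (arc i).Covers A then z i else 0

/-- The weight of the arcs that start at `B` minus the weight of those that end at `B`. -/
noncomputable def excess {V E ι : Type*} (arc : ι → Arc V E) (L : Finset (Biset V))
    (F : Finset ι) (z : ι → ℝ) (B : Biset V) : ℝ :=
  ∑ i ∈ F, z i * (arc i).incidence L B

section

variable {V E ι : Type*} {arc : ι → Arc V E} {L : Finset (Biset V)} {F : Finset ι}

open Classical in
theorem sum_excess [DecidableEq V] (hL : Biset.Laminar L) (z : ι → ℝ) {A : Biset V}
    (hA : A ∈ L) : ∑ B ∈ L with B ≤ A, excess arc L F z B = cutSum arc F z A := by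
  simp only [excess, cutSum]
  rw [Finset.sum_comm]
  refine Finset.sum_congr rfl fun i _ => ?_
  rw [← Finset.mul_sum, Arc.sum_incidence hL _ hA, mul_ite, mul_one, mul_zero]

/-- By Möbius inversion over the laminar family, integrality passes from the cut weights to the
excesses. -/
theorem excess_mem [DecidableEq V] (hL : Biset.Laminar L) (z : ι → ℝ) (H : AddSubgroup ℝ)
    (hz : ∀ A ∈ L, cutSum arc F z A ∈ H) {A : Biset V} (hA : A ∈ L) :
    excess arc L F z A ∈ H := by
  classical
  by_contra hcon
  obtain ⟨B, hB⟩ := Finset.exists_minimal (s := L.filter fun C => excess arc L F z C ∉ H)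
    ⟨A, by simp [hA, hcon]⟩
  have hm := Finset.mem_filter.1 hB.prop
  apply hm.2
  have hs := sum_excess (arc := arc) (F := F) hL z hm.1
  have hmem : B ∈ L.filter fun C => C ≤ B := by simp [hm.1]
  rw [← Finset.add_sum_erase _ _ hmem, ← eq_sub_iff_add_eq] at hs
  rw [hs]
  refine H.sub_mem (hz B hm.1) (H.sum_mem fun C hC => ?_)
  simp only [Finset.mem_erase, Finset.mem_filter] at hC
  by_contra hn
  exact hC.1 (le_antisymm hC.2.2 (hB.le_of_le (by simp [hC.2.1, hn]) hC.2.2))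

/-- A homogeneous linear system with fewer equations than unknowns has a nonzero solution. -/
theorem exists_ne_zero_sum_mul_eq_zero {ι β : Type*} (N : Finset β) (F : Finset ι)
    (h : N.card < F.card) (M : ι → β → ℝ) :
    ∃ z : ι → ℝ, z ≠ 0 ∧ (∀ i ∉ F, z i = 0) ∧ ∀ b ∈ N, ∑ i ∈ F, z i * M i b = 0 := by
  classical
  let Φ : (F → ℝ) →ₗ[ℝ] (N → ℝ) :=
    LinearMap.pi fun b => ∑ i : F, M i b • LinearMap.proj i
  have hΦ : LinearMap.ker Φ ≠ ⊥ := LinearMap.ker_ne_bot_of_finrank_lt (by simpa using h)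
  obtain ⟨w, hw, hw0⟩ := (Submodule.ne_bot_iff _).1 hΦ
  refine ⟨fun i => if hi : i ∈ F then w ⟨i, hi⟩ else 0, ?_, fun i hi => dif_neg hi, ?_⟩
  · intro h0
    apply hw0
    funext i
    simpa using congrFun h0 i
  · intro b hb
    have := congrFun (LinearMap.mem_ker.1 hw) ⟨b, hb⟩
    simp only [Φ, LinearMap.pi_apply, LinearMap.sum_apply, LinearMap.smul_apply,
      LinearMap.proj_apply, smul_eq_mul, Pi.zero_apply] at this
    rw [← Finset.sum_coe_sort, ← this]
    refine Finset.sum_congr rfl fun i _ => ?_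
    simp [mul_comm]

/-- If a laminar family has integral cut weights for a weight `y` that is strictly between `0`
and `1` on `F`, then it does not determine `y` on `F`: some nonzero perturbation has zero weight
on each of its cuts. The reason is a count of tokens. Every arc gives `y i` to the member where
it starts and `1 - y i` to the member where it ends; a member that receives anything receives
a positive integer, hence at least `1`; and an arc that covers a maximal member ends nowhere and
keeps `1 - y i`. So fewer than `F.card` of the equations are nontrivial. -/
theorem exists_perturbation_of_laminar [DecidableEq V] (hL : Biset.Laminar L)
    (hF : F.Nonempty) (y : ι → ℝ) (hy : ∀ i ∈ F, 0 < y i ∧ y i < 1)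
    (hint : ∀ A ∈ L, ∃ n : ℤ, cutSum arc F y A = n)
    (hne : ∀ A ∈ L, ∃ i ∈ F, (arc i).Covers A) :
    ∃ z : ι → ℝ, z ≠ 0 ∧ (∀ i ∉ F, z i = 0) ∧ ∀ A ∈ L, cutSum arc F z A = 0 := by
  classical
  let token : ι → Biset V → ℝ := fun i B =>
    y i * (if (arc i).StartsAt L B then 1 else 0) +
      (1 - y i) * (if (arc i).EndsAt L B then 1 else 0)
  let N : Finset (Biset V) :=
    L.filter fun B => ∃ i ∈ F, (arc i).StartsAt L B ∨ (arc i).EndsAt L B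
  have htoken0 : ∀ i ∈ F, ∀ B, 0 ≤ token i B := by
    intro i hi B
    have := hy i hi
    have h1 : (0 : ℝ) ≤ 1 - y i := by linarith
    have h2 : (0 : ℝ) ≤ y i := this.1.le
    simp only [token]
    split_ifs <;> simp [h1, h2]
  have hN1 : ∀ B ∈ N, 1 ≤ ∑ i ∈ F, token i B := by
    intro B hB
    obtain ⟨hBL, i, hi, hse⟩ := Finset.mem_filter.1 hB
    have hpos : 0 < ∑ i ∈ F, token i B := by
      refine Finset.sum_pos' (fun i hi => htoken0 i hi B) ⟨i, hi, ?_⟩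
      have h1 : (0 : ℝ) < 1 - y i := by linarith [hy i hi]
      have h2 : (0 : ℝ) < y i := (hy i hi).1
      simp only [token]
      rcases hse with h | h
      · rw [if_pos h]; split_ifs <;> linarith
      · rw [if_pos h]; split_ifs <;> linarith
    have hmem : excess arc L F y B ∈ (Int.castAddHom ℝ).range :=
      excess_mem hL y _ (fun A hA => by
        obtain ⟨n, hn⟩ := hint A hA
        exact ⟨n, by simp [hn]⟩) hBL
    obtain ⟨n, hn⟩ := hmem
    have hsum : ∑ i ∈ F, token i B
        = ((n + ((F.filter fun i => (arc i).EndsAt L B).card : ℤ) : ℤ) : ℝ) := by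
      push_cast
      rw [show (n : ℝ) = excess arc L F y B from hn, Finset.card_filter, Nat.cast_sum, excess,
        ← Finset.sum_add_distrib]
      refine Finset.sum_congr rfl fun i _ => ?_
      simp only [token, Arc.incidence]
      push_cast
      ring
    rw [hsum] at hpos ⊢
    have hpos' := Int.cast_pos.1 hpos
    exact_mod_cast (by omega : 1 ≤ n + ((F.filter fun i => (arc i).EndsAt L B).card : ℤ))
  -- An arc through a maximal member of `L`, or any arc if `L` is empty, has no end.
  have hroot : ∃ i ∈ F, ∀ B, ¬ (arc i).EndsAt L B := by
    rcases L.eq_empty_or_nonempty with h | h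
    · obtain ⟨i, hi⟩ := hF
      refine ⟨i, hi, fun B hB => ?_⟩
      have := hB.2.1
      simp [h] at this
    · obtain ⟨A, hA⟩ := Finset.exists_maximal h
      obtain ⟨i, hi, hc⟩ := hne A hA.prop
      refine ⟨i, hi, fun B hB => hB.2.2.2.1 ?_⟩
      have hBA : B ≤ A := by
        rcases hL B hB.2.1 A hA.prop (Biset.intersect_of_mem hB.2.2.1 hc.1) with h | h
        · exact h
        · exact hA.le_of_ge hB.2.1 h
      exact hc.anti hBA hB.2.2.1
  have hS : ∀ i, ∑ B ∈ N, (if (arc i).StartsAt L B then (1 : ℝ) else 0) ≤ 1 := by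
    intro i
    rw [sum_ite_of_unique _ _ fun _ _ => Arc.StartsAt.unique]
    split_ifs <;> norm_num
  have hE : ∀ i, ∑ B ∈ N, (if (arc i).EndsAt L B then (1 : ℝ) else 0) ≤ 1 := by
    intro i
    rw [sum_ite_of_unique _ _ fun _ _ => Arc.EndsAt.unique]
    split_ifs <;> norm_num
  have hcard : N.card < F.card := by
    have h1 : (N.card : ℝ) ≤ ∑ B ∈ N, ∑ i ∈ F, token i B := by
      simpa using Finset.sum_le_sum hN1
    have h2 : ∑ B ∈ N, ∑ i ∈ F, token i B < ∑ i ∈ F, (1 : ℝ) := by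
      rw [Finset.sum_comm]
      obtain ⟨j, hj, hje⟩ := hroot
      refine Finset.sum_lt_sum (fun i hi => ?_) ⟨j, hj, ?_⟩
      · simp only [token, Finset.sum_add_distrib, ← Finset.mul_sum]
        nlinarith [hS i, hE i, hy i hi]
      · simp only [token, Finset.sum_add_distrib, ← Finset.mul_sum]
        simp only [if_neg (hje _), Finset.sum_const_zero, mul_zero, add_zero]
        nlinarith [hS j, hy j hj]
    have h3 : (N.card : ℝ) < F.card := by
      refine h1.trans_lt (h2.trans_le ?_)
      simp
    exact_mod_cast h3
  obtain ⟨z, hz0, hzF, hz⟩ := exists_ne_zero_sum_mul_eq_zero N F hcard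
    (fun i B => (arc i).incidence L B)
  refine ⟨z, hz0, hzF, fun A hA => ?_⟩
  rw [← sum_excess hL z hA]
  refine Finset.sum_eq_zero fun B hB => ?_
  by_cases hBN : B ∈ N
  · exact hz B hBN
  · refine Finset.sum_eq_zero fun i hi => ?_
    have hno : ¬ ((arc i).StartsAt L B ∨ (arc i).EndsAt L B) := fun h =>
      hBN (Finset.mem_filter.2 ⟨(Finset.mem_filter.1 hB).1, i, hi, h⟩)
    rw [not_or] at hno
    simp [Arc.incidence, hno.1, hno.2]

end

/-! ### Uncrossing of tight bisets -/

namespace Biset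

/-- Two bisets cross if their inner parts meet and neither contains the other. -/
def Crosses {V : Type*} [DecidableEq V] (A B : Biset V) : Prop :=
  A.Intersect B ∧ ¬ A ≤ B ∧ ¬ B ≤ A

theorem Intersect.symm {V : Type*} [DecidableEq V] {A B : Biset V} (h : A.Intersect B) :
    B.Intersect A := by
  rwa [Intersect, Finset.inter_comm]

theorem inter_le_left {V : Type*} [DecidableEq V] (A B : Biset V) : A ∩ B ≤ A :=
  ⟨Finset.inter_subset_left, Finset.inter_subset_left⟩

theorem inter_le_right {V : Type*} [DecidableEq V] (A B : Biset V) : A ∩ B ≤ B :=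
  ⟨Finset.inter_subset_right, Finset.inter_subset_right⟩

theorem le_union_left {V : Type*} [DecidableEq V] (A B : Biset V) : A ≤ A ∪ B :=
  ⟨Finset.subset_union_left, Finset.subset_union_left⟩

theorem le_union_right {V : Type*} [DecidableEq V] (A B : Biset V) : B ≤ A ∪ B :=
  ⟨Finset.subset_union_right, Finset.subset_union_right⟩

theorem le_inter {V : Type*} [DecidableEq V] {A B C : Biset V} (hA : C ≤ A) (hB : C ≤ B) :
    C ≤ A ∩ B :=
  ⟨Finset.subset_inter hA.1 hB.1, Finset.subset_inter hA.2 hB.2⟩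

theorem union_le {V : Type*} [DecidableEq V] {A B C : Biset V} (hA : A ≤ C) (hB : B ≤ C) :
    A ∪ B ≤ C :=
  ⟨Finset.union_subset hA.1 hB.1, Finset.union_subset hA.2 hB.2⟩

/-- If `B` and `C` do not cross, a biset `C` that crosses `A ∩ B` already crosses `A`. -/
theorem Crosses.of_inter {V : Type*} [DecidableEq V] {A B C : Biset V}
    (hBC : B.Intersect C → B ≤ C ∨ C ≤ B) (h : (A ∩ B).Crosses C) : A.Crosses C := by
  obtain ⟨⟨v, hv⟩, h1, h2⟩ := h
  have hvC := (Finset.mem_inter.1 hv).2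
  have hvAB := (Finset.mem_inter.1 hv).1
  have hvA := (inter_le_left A B).1 hvAB
  have hvB := (inter_le_right A B).1 hvAB
  refine ⟨intersect_of_mem hvA hvC, fun hAC => h1 ((inter_le_left A B).trans hAC),
    fun hCA => ?_⟩
  rcases hBC (intersect_of_mem hvB hvC) with h | h
  · exact h1 ((inter_le_right A B).trans h)
  · exact h2 (le_inter hCA h)

/-- If `B` and `C` do not cross and `A` meets `B`, a biset `C` that crosses `A ∪ B` already
crosses `A`. -/
theorem Crosses.of_union {V : Type*} [DecidableEq V] {A B C : Biset V} (hAB : A.Intersect B)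
    (hBC : B.Intersect C → B ≤ C ∨ C ≤ B) (h : (A ∪ B).Crosses C) : A.Crosses C := by
  obtain ⟨⟨v, hv⟩, h1, h2⟩ := h
  obtain ⟨w, hw⟩ := hAB
  have hwA := (Finset.mem_inter.1 hw).1
  have hwB := (Finset.mem_inter.1 hw).2
  have hvC := (Finset.mem_inter.1 hv).2
  by_cases hi : B.Intersect C
  · rcases hBC hi with h | h
    · exact ⟨intersect_of_mem hwA (h.1 hwB), fun hAC => h1 (union_le hAC h),
        fun hCA => h2 (hCA.trans (le_union_left A B))⟩
    · exact absurd (h.trans (le_union_right A B)) h2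
  · have hvA : v ∈ A.inner := by
      rcases Finset.mem_union.1 (Finset.mem_inter.1 hv).1 with h | h
      · exact h
      · exact absurd (intersect_of_mem h hvC) hi
    exact ⟨intersect_of_mem hvA hvC, fun hAC => hi (intersect_of_mem hwB (hAC.1 hwA)),
      fun hCA => h2 (hCA.trans (le_union_left A B))⟩

end Biset

open Classical in
/-- Each arc covers at most as many of `A ∩ B` and `A ∪ B` as of `A` and `B`. -/
theorem Arc.covers_submodular {V E : Type*} [DecidableEq V] (a : Arc V E) (A B : Biset V) :
    (if a.Covers (A ∩ B) then (1 : ℝ) else 0) + (if a.Covers (A ∪ B) then 1 else 0)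
      ≤ (if a.Covers A then 1 else 0) + (if a.Covers B then 1 else 0) := by
  have hi : a.Covers (A ∩ B) ↔ (a.tail ∈ A.inner ∧ a.tail ∈ B.inner) ∧
      ¬ (a.head ∈ A.outer ∧ a.head ∈ B.outer) :=
    and_congr Finset.mem_inter (not_congr Finset.mem_inter)
  have hu : a.Covers (A ∪ B) ↔ (a.tail ∈ A.inner ∨ a.tail ∈ B.inner) ∧
      ¬ (a.head ∈ A.outer ∨ a.head ∈ B.outer) :=
    and_congr Finset.mem_union (not_congr Finset.mem_union)
  simp only [hi, hu]
  simp only [Arc.Covers]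
  by_cases h1 : a.tail ∈ A.inner <;> by_cases h2 : a.tail ∈ B.inner <;>
    by_cases h3 : a.head ∈ A.outer <;> by_cases h4 : a.head ∈ B.outer <;>
    simp [h1, h2, h3, h4]

open Classical in
theorem cutSum_eq_sum_mul {V E ι : Type*} {arc : ι → Arc V E} (F : Finset ι)
    (z : ι → ℝ) (A : Biset V) :
    cutSum arc F z A = ∑ i ∈ F, z i * if (arc i).Covers A then 1 else 0 := by
  simp [cutSum]

theorem cutSum_eq_zero {V E ι : Type*} {arc : ι → Arc V E} {F : Finset ι}
    {z : ι → ℝ} {A : Biset V}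
    (h : ∀ i ∈ F, (arc i).Covers A → z i = 0) : cutSum arc F z A = 0 := by
  classical
  refine Finset.sum_eq_zero fun i hi => ?_
  split_ifs with hc
  · exact h i hi hc
  · rfl

theorem continuous_cutSum {V E ι : Type*} [Fintype ι] (arc : ι → Arc V E) (A : Biset V) :
    Continuous fun y : ι → ℝ => cutSum arc Finset.univ y A := by
  simp only [cutSum_eq_sum_mul]
  fun_prop

theorem cutSum_add_smul {V E ι : Type*} [Fintype ι] (arc : ι → Arc V E)
    (y z : ι → ℝ) (ε : ℝ) (A : Biset V) :
    cutSum arc Finset.univ (y + ε • z) A =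
      cutSum arc Finset.univ y A + ε * cutSum arc Finset.univ z A := by
  simp only [cutSum_eq_sum_mul, Finset.mul_sum, ← Finset.sum_add_distrib, Pi.add_apply,
    Pi.smul_apply, smul_eq_mul]
  exact Finset.sum_congr rfl fun i _ => by ring

section

variable {V E ι : Type*} [DecidableEq V] {arc : ι → Arc V E} {g : Biset V → ℤ}

/-- If `A` and `B` are intersecting tight bisets, then so are `A ∩ B` and `A ∪ B`, and on the
support of `y` the cuts of the two pairs have the same characteristic vectors. -/
theorem tight_uncross [Fintype ι] (hg : Biset.PositivelyIntersectingSupermodular g)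
    {y : ι → ℝ} (hy : ∀ i, 0 ≤ y i) (hf : ∀ A, (g A : ℝ) ≤ cutSum arc Finset.univ y A)
    {A B : Biset V} (hA : cutSum arc Finset.univ y A = g A)
    (hB : cutSum arc Finset.univ y B = g B) (hgA : 0 < g A) (hgB : 0 < g B)
    (hAB : A.Intersect B) :
    cutSum arc Finset.univ y (A ∩ B) = g (A ∩ B) ∧
      cutSum arc Finset.univ y (A ∪ B) = g (A ∪ B) ∧
      ∀ z : ι → ℝ, (∀ i, y i = 0 → z i = 0) →
        cutSum arc Finset.univ z A + cutSum arc Finset.univ z B =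
          cutSum arc Finset.univ z (A ∩ B) + cutSum arc Finset.univ z (A ∪ B) := by
  classical
  have hsup : (g A : ℝ) + g B ≤ g (A ∩ B) + g (A ∪ B) := by
    exact_mod_cast hg A B hgA hgB hAB
  let slack : ι → ℝ := fun i =>
    (if (arc i).Covers A then (1 : ℝ) else 0) + (if (arc i).Covers B then 1 else 0) -
      ((if (arc i).Covers (A ∩ B) then (1 : ℝ) else 0) +
        (if (arc i).Covers (A ∪ B) then 1 else 0))
  have hslack : ∀ i, 0 ≤ slack i := fun i => sub_nonneg.2 ((arc i).covers_submodular A B)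
  have hsum : ∀ z : ι → ℝ, ∑ i, z i * slack i =
      cutSum arc Finset.univ z A + cutSum arc Finset.univ z B -
        (cutSum arc Finset.univ z (A ∩ B) + cutSum arc Finset.univ z (A ∪ B)) := by
    intro z
    simp only [cutSum_eq_sum_mul, ← Finset.sum_add_distrib, ← Finset.sum_sub_distrib]
    refine Finset.sum_congr rfl fun i _ => ?_
    simp only [slack]
    ring
  have hnn : ∀ i ∈ Finset.univ, 0 ≤ y i * slack i := fun i _ => mul_nonneg (hy i) (hslack i)
  have hs := Finset.sum_nonneg hnn
  have hi := hf (A ∩ B)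
  have hu := hf (A ∪ B)
  have hs' := hsum y
  refine ⟨by linarith, by linarith, fun z hz => ?_⟩
  have hzero := (Finset.sum_eq_zero_iff_of_nonneg hnn).1 (by linarith)
  have : ∑ i, z i * slack i = 0 := Finset.sum_eq_zero fun i hi => by
    rcases mul_eq_zero.1 (hzero i hi) with h | h
    · rw [hz i h, zero_mul]
    · rw [h, mul_zero]
  linarith [hsum z]

/-- A feasible vector with fractional entries can be perturbed along a nonzero direction that
is supported on the fractional entries and preserves all tight constraints. A maximal laminar
family of tight bisets crossed by fractional arcs is enough to control all tight bisets, by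
induction on the number of members of the family that a tight biset crosses. -/
theorem exists_perturbation [Finite V] [Fintype ι]
    (hg : Biset.PositivelyIntersectingSupermodular g) {y : ι → ℝ}
    (hy : ∀ i, 0 ≤ y i ∧ y i ≤ 1) (hf : ∀ A, (g A : ℝ) ≤ cutSum arc Finset.univ y A)
    (hfrac : ∃ i, y i ≠ 0 ∧ y i ≠ 1) :
    ∃ z : ι → ℝ, z ≠ 0 ∧ (∀ i, y i = 0 ∨ y i = 1 → z i = 0) ∧
      ∀ A, cutSum arc Finset.univ y A = g A → cutSum arc Finset.univ z A = 0 := by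
  classical
  have : Fintype (Biset V) := Fintype.ofFinite _
  let F : Finset ι := Finset.univ.filter fun i => y i ≠ 0 ∧ y i ≠ 1
  have hF : ∀ i, i ∈ F ↔ y i ≠ 0 ∧ y i ≠ 1 := fun i => by simp [F]
  have hFy : ∀ i ∈ F, 0 < y i ∧ y i < 1 := fun i hi =>
    ⟨lt_of_le_of_ne (hy i).1 (Ne.symm ((hF i).1 hi).1), lt_of_le_of_ne (hy i).2 ((hF i).1 hi).2⟩
  let T : Finset (Biset V) := Finset.univ.filter fun A =>
    cutSum arc Finset.univ y A = g A ∧ ∃ i ∈ F, (arc i).Covers A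
  have hT : ∀ A, A ∈ T ↔ cutSum arc Finset.univ y A = g A ∧ ∃ i ∈ F, (arc i).Covers A :=
    fun A => by simp [T]
  have hTpos : ∀ A ∈ T, 0 < g A := by
    intro A hA
    obtain ⟨ht, i, hi, hc⟩ := (hT A).1 hA
    have : 0 < cutSum arc Finset.univ y A := by
      refine Finset.sum_pos' (fun j _ => ?_) ⟨i, Finset.mem_univ i, ?_⟩
      · split_ifs
        exacts [(hy j).1, le_rfl]
      · rw [if_pos hc]
        exact (hFy i hi).1
    rw [ht] at this
    exact_mod_cast this
  obtain ⟨L, hL⟩ := Finset.exists_maximal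
    (s := T.powerset.filter fun L => Biset.Laminar L) ⟨∅, by
      rw [Finset.mem_filter]; exact ⟨Finset.empty_mem_powerset T, by simp [Biset.Laminar]⟩⟩
  obtain ⟨hLT, hLl⟩ := Finset.mem_filter.1 hL.prop
  rw [Finset.mem_powerset] at hLT
  have hint : ∀ A ∈ L, ∃ n : ℤ, cutSum arc F y A = n := by
    intro A hA
    have ht := ((hT A).1 (hLT hA)).1
    refine ⟨g A - ((Finset.univ.filter fun i => y i = 1 ∧ (arc i).Covers A).card : ℤ), ?_⟩
    push_cast
    rw [← ht, eq_sub_iff_add_eq, Finset.card_filter, Nat.cast_sum]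
    simp only [cutSum, F, Finset.sum_filter]
    rw [← Finset.sum_add_distrib]
    refine Finset.sum_congr rfl fun i _ => ?_
    by_cases h0 : y i = 0
    · simp [h0]
    · by_cases h1 : y i = 1
      · simp [h1]
      · simp [h0, h1]
  obtain ⟨z, hz0, hzF, hzL⟩ := exists_perturbation_of_laminar hLl
    (by obtain ⟨i, hi⟩ := hfrac; exact ⟨i, (hF i).2 hi⟩) y hFy hint
    (fun A hA => ((hT A).1 (hLT hA)).2)
  have hzz : ∀ i, y i = 0 ∨ y i = 1 → z i = 0 := fun i hi => hzF i fun h => by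
    rcases hi with h' | h'
    exacts [((hF i).1 h).1 h', ((hF i).1 h).2 h']
  have hcut : ∀ A, cutSum arc F z A = cutSum arc Finset.univ z A := fun A =>
    Finset.sum_subset (Finset.subset_univ _) fun i _ hi => by simp [hzF i hi]
  have hnoF : ∀ A, (¬ ∃ i ∈ F, (arc i).Covers A) → cutSum arc Finset.univ z A = 0 := by
    intro A hA
    rw [← hcut]
    exact cutSum_eq_zero fun i hi hc => absurd ⟨i, hi, hc⟩ hA
  have hmain : ∀ n : ℕ, ∀ A ∈ T, (L.filter fun C => A.Crosses C).card = n →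
      cutSum arc Finset.univ z A = 0 := by
    intro n
    induction n using Nat.strong_induction_on with
    | _ n ih =>
      intro A hA hn
      have htA := ((hT A).1 hA).1
      by_cases hcr : ∃ B ∈ L, A.Crosses B
      · obtain ⟨B, hB, hAB⟩ := hcr
        obtain ⟨hi, hu, hmod⟩ := tight_uncross hg (fun i => (hy i).1) hf htA
          ((hT B).1 (hLT hB)).1 (hTpos A hA) (hTpos B (hLT hB)) hAB.1
        have hstep : ∀ D, cutSum arc Finset.univ y D = g D →
            (∀ C ∈ L, D.Crosses C → A.Crosses C) → ¬ D.Crosses B →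
            cutSum arc Finset.univ z D = 0 := by
          intro D hD hsub hDB
          by_cases hDF : ∃ i ∈ F, (arc i).Covers D
          · refine ih _ ?_ D ((hT D).2 ⟨hD, hDF⟩) rfl
            rw [← hn]
            refine Finset.card_lt_card (Finset.ssubset_iff_of_subset ?_ |>.2
              ⟨B, by simp [hB, hAB], by simp [hDB]⟩)
            intro C hC
            rw [Finset.mem_filter] at hC ⊢
            exact ⟨hC.1, hsub C hC.1 hC.2⟩
          · exact hnoF D hDF
        have h1 := hstep _ hi (fun C hC h => h.of_inter (hLl B hB C hC))
          fun h => h.2.1 (Biset.inter_le_right A B)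
        have h2 := hstep _ hu (fun C hC h => h.of_union hAB.1 (hLl B hB C hC))
          fun h => h.2.2 (Biset.le_union_right A B)
        have h3 : cutSum arc Finset.univ z B = 0 := by rw [← hcut]; exact hzL B hB
        have h4 := hmod z fun i hi => hzz i (Or.inl hi)
        linarith
      · push Not at hcr
        -- Now `A` can be added to `L`, hence belongs to it by maximality.
        have hlam : Biset.Laminar (insert A L) := by
          have key : ∀ C ∈ L, A.Intersect C → A ≤ C ∨ C ≤ A := fun C hC hAC => by
            by_contra hcon
            rw [not_or] at hcon
            exact hcr C hC ⟨hAC, hcon.1, hcon.2⟩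
          intro C hC D hD hCD
          rcases Finset.mem_insert.1 hC with rfl | hC' <;>
            rcases Finset.mem_insert.1 hD with rfl | hD'
          · exact Or.inl le_rfl
          · exact key D hD' hCD
          · exact (key C hC' hCD.symm).symm
          · exact hLl C hC' D hD' hCD
        have hAL : A ∈ L := hL.le_of_ge
          (Finset.mem_filter.2 ⟨Finset.mem_powerset.2 (Finset.insert_subset hA hLT), hlam⟩)
          (Finset.subset_insert A L) (Finset.mem_insert_self A L)
        rw [← hcut]
        exact hzL A hAL
  refine ⟨z, hz0, hzz, fun A hA => ?_⟩
  by_cases hAF : ∃ i ∈ F, (arc i).Covers A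
  · exact hmain _ A ((hT A).2 ⟨hA, hAF⟩) rfl
  · exact hnoF A hAF

end

/-! ### Integrality of the directed linear program -/

section

variable {V E ι : Type*} [Fintype ι]

/-- The fractional directed covers of `g`: the vectors in the unit cube that satisfy the
covering constraints. -/
def coverPolytope (arc : ι → Arc V E) (g : Biset V → ℤ) : Set (ι → ℝ) :=
  {y | (∀ i, 0 ≤ y i ∧ y i ≤ 1) ∧ ∀ A, (g A : ℝ) ≤ cutSum arc Finset.univ y A}

theorem isCompact_coverPolytope (arc : ι → Arc V E) (g : Biset V → ℤ) :
    IsCompact (coverPolytope arc g) := by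
  have h : coverPolytope arc g = Set.Icc 0 1 ∩
      ⋂ A, {y | (g A : ℝ) ≤ cutSum arc Finset.univ y A} := by
    ext y
    simp [coverPolytope, Pi.le_def, forall_and]
  rw [h]
  exact isCompact_Icc.inter_right
    (isClosed_iInter fun A => isClosed_le continuous_const (continuous_cutSum arc A))

open Filter Topology in
/-- A direction that vanishes on the tight constraints stays in the polytope for small steps. -/
theorem eventually_mem_coverPolytope [Finite V] {arc : ι → Arc V E} {g : Biset V → ℤ}
    {y z : ι → ℝ}
    (hy : y ∈ coverPolytope arc g) (hz : ∀ i, y i = 0 ∨ y i = 1 → z i = 0)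
    (hzt : ∀ A, cutSum arc Finset.univ y A = g A → cutSum arc Finset.univ z A = 0) :
    ∀ᶠ ε : ℝ in 𝓝 0, y + ε • z ∈ coverPolytope arc g := by
  have hlim : ∀ a b : ℝ, Tendsto (fun ε : ℝ => a + ε * b) (𝓝 0) (𝓝 a) := fun a b => by
    have : Continuous fun ε : ℝ => a + ε * b := by fun_prop
    simpa using this.tendsto 0
  refine Eventually.and (eventually_all.2 fun i => ?_) (eventually_all.2 fun A => ?_)
  · simp only [Pi.add_apply, Pi.smul_apply, smul_eq_mul]
    by_cases h : y i = 0 ∨ y i = 1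
    · exact Eventually.of_forall fun ε => by simpa [hz i h] using hy.1 i
    · rw [not_or] at h
      exact ((hlim (y i) (z i)).eventually
        (Ioo_mem_nhds (lt_of_le_of_ne (hy.1 i).1 (Ne.symm h.1))
          (lt_of_le_of_ne (hy.1 i).2 h.2))).mono fun ε hε => ⟨hε.1.le, hε.2.le⟩
  · simp only [cutSum_add_smul]
    by_cases h : cutSum arc Finset.univ y A = g A
    · exact Eventually.of_forall fun ε => by rw [hzt A h, mul_zero, add_zero]; exact hy.2 A
    · exact ((hlim _ _).eventually
        (Ioi_mem_nhds (lt_of_le_of_ne (hy.2 A) (Ne.symm h)))).mono fun ε hε => le_of_lt hε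

open Filter Topology in
/-- The directed covering linear program is integral: every fractional cover can be replaced by
a `0`-`1` vector in the polytope that costs no more. -/
theorem exists_integral_mem_coverPolytope [DecidableEq V] [Finite V]
    {arc : ι → Arc V E} {g : Biset V → ℤ}
    (hg : Biset.PositivelyIntersectingSupermodular g) (c : ι → ℝ) {y₀ : ι → ℝ}
    (hy₀ : y₀ ∈ coverPolytope arc g) :
    ∃ y ∈ coverPolytope arc g, (∀ i, y i = 0 ∨ y i = 1) ∧
      ∑ i, c i * y i ≤ ∑ i, c i * y₀ i := by
  have hcont : Continuous fun y : ι → ℝ => ∑ i, c i * y i := by fun_prop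
  obtain ⟨m, hm, hmin⟩ :=
    (isCompact_coverPolytope arc g).exists_isMinOn ⟨y₀, hy₀⟩ hcont.continuousOn
  have hmin' : ∀ w ∈ coverPolytope arc g, ∑ i, c i * m i ≤ ∑ i, c i * w i := hmin
  -- An extreme point of the set of optimal solutions.
  obtain ⟨y, hy⟩ := IsCompact.extremePoints_nonempty
    (s := coverPolytope arc g ∩ {y | ∑ i, c i * y i ≤ ∑ i, c i * m i})
    ((isCompact_coverPolytope arc g).inter_right (isClosed_le hcont continuous_const))
    ⟨m, hm, le_refl (∑ i, c i * m i)⟩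
  obtain ⟨⟨hyP, hyc⟩, hext⟩ := mem_extremePoints.1 hy
  refine ⟨y, hyP, ?_, le_trans hyc (hmin' y₀ hy₀)⟩
  by_contra hfrac
  push Not at hfrac
  obtain ⟨z, hz0, hz, hzt⟩ := exists_perturbation hg hyP.1 hyP.2 hfrac
  have hev := eventually_mem_coverPolytope hyP hz hzt
  have hneg : Tendsto (fun ε : ℝ => -ε) (𝓝 0) (𝓝 0) := by
    simpa using (continuous_neg (G := ℝ)).tendsto 0
  obtain ⟨ε, ⟨h1, h2⟩, hε⟩ := (((hev.and (hneg.eventually hev)).filter_mono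
    nhdsWithin_le_nhds).and (self_mem_nhdsWithin (s := Set.Ioi (0 : ℝ)))).exists
  replace hε : 0 < ε := hε
  have hval : ∀ t : ℝ, ∑ i, c i * (y + t • z) i = ∑ i, c i * y i + t * ∑ i, c i * z i := by
    intro t
    simp only [Finset.mul_sum, ← Finset.sum_add_distrib, Pi.add_apply, Pi.smul_apply,
      smul_eq_mul]
    exact Finset.sum_congr rfl fun i _ => by ring
  have hyc' : ∑ i, c i * y i ≤ ∑ i, c i * m i := hyc
  have e1 := hmin' _ h1
  have e2 := hmin' _ h2
  rw [hval] at e1 e2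
  -- Both signs of the step are feasible, so the cost does not change along `z`.
  have hcz : ε * ∑ i, c i * z i = 0 := by linarith
  have hseg : y ∈ openSegment ℝ (y + ε • z) (y + (-ε) • z) := by
    refine ⟨1 / 2, 1 / 2, by norm_num, by norm_num, by norm_num, ?_⟩
    module
  have heq := (hext _ ⟨h1, by rw [Set.mem_ofPred_eq, hval]; linarith⟩ _
    ⟨h2, by rw [Set.mem_ofPred_eq, hval]; linarith⟩ hseg).1
  rw [add_eq_left, smul_eq_zero] at heq
  rcases heq with h | h
  exacts [hε.ne' h, hz0 h]

end

/-! ### From the undirected relaxation to directed covers -/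

instance {V E : Type*} [Finite V] [Finite E] : Finite (Arc V E) :=
  Finite.of_injective (fun a : Arc V E => (a.edge, a.tail, a.head)) fun a b h => by
    cases a; cases b; simpa using h

namespace UGraph

variable {V E : Type*}

/-- An edge has at most one orientation that covers a given biset. -/
theorem arc_eq_of_covers {G : UGraph V E} {a b : Arc V E} {A : Biset V}
    (ha : G.ends a.edge = s(a.tail, a.head)) (hb : G.ends b.edge = s(b.tail, b.head))
    (hab : a.edge = b.edge) (haA : a.Covers A) (hbA : b.Covers A) : a = b := by
  obtain ⟨e, u, v⟩ := a
  obtain ⟨e', u', v'⟩ := b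
  dsimp only at ha hb hab
  subst hab
  rw [ha, Sym2.eq_iff] at hb
  rcases hb with ⟨rfl, rfl⟩ | ⟨rfl, rfl⟩
  · rfl
  · exact absurd (A.subset haA.1) hbA.2

variable [Fintype V] [DecidableEq V] [Fintype E] {G : UGraph V E} {R : Finset V}

/-- The area function is positive only on bisets whose inner part avoids `R`. -/
theorem area_pos_disjoint {f : Biset V → ℤ} (hf : 0 ≤ Biset.maxValue f) {A : Biset V}
    (hA : 0 < Biset.area f R A) {v : V} (hv : v ∈ A.inner) : v ∉ R := by
  intro hvR
  have h1 : f A ≤ Biset.maxValue f := (Biset.isGreatest_maxValue f).2 ⟨A, rfl⟩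
  have h2 : (1 : ℤ) ≤ ((A.inner ∩ R).card : ℤ) := by
    exact_mod_cast Finset.card_pos.2 ⟨v, Finset.mem_inter.2 ⟨hv, hvR⟩⟩
  have h3 := mul_le_mul_of_nonneg_left h2 hf
  simp only [Biset.area] at hA
  linarith

/-- Every edge that covers a biset whose inner part avoids `R` has an orientation among
`G.areaArcs R` that covers this biset. -/
theorem exists_arc_of_covers {e : E} {A : Biset V} (hA : ∀ v ∈ A.inner, v ∉ R)
    (he : G.Covers e A) : ∃ a ∈ G.areaArcs R, a.Covers A ∧ a.edge = e := by
  obtain ⟨u, hu, v, hv, huv⟩ := he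
  refine ⟨⟨e, u, v⟩, ⟨huv, ?_⟩, ⟨hu, hv⟩, rfl⟩
  by_cases hvR : v ∈ R
  · refine Or.inr ⟨?_, hvR⟩
    simp only [cut, Finset.mem_filter, Finset.mem_univ, true_and]
    exact ⟨v, hvR, u, hA u hu, by rw [huv, Sym2.eq_swap]⟩
  · left
    simp only [inside, Finset.mem_filter, Finset.mem_univ, true_and, huv, Sym2.mem_iff]
    rintro w (rfl | rfl)
    · simpa using hA _ hu
    · simpa using hvR

open Classical in
/-- Giving each arc the value of its edge turns a feasible solution of the Biset-LP for the area
function into a fractional directed cover. -/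
theorem area_le_sum_arcs {f : Biset V → ℤ} (hf : 0 ≤ Biset.maxValue f) {x : E → ℝ}
    (hx : G.BisetLPFeasible (Biset.area f R) x) {D : Finset (Arc V E)}
    (hD : ∀ a, a ∈ D ↔ a ∈ G.areaArcs R) (A : Biset V) :
    (Biset.area f R A : ℝ) ≤ ∑ a ∈ D with a.Covers A, x a.edge := by
  rcases le_or_gt (Biset.area f R A) 0 with h | h
  · refine le_trans (by exact_mod_cast h) (Finset.sum_nonneg fun a _ => (hx.2 a.edge).1)
  · refine (hx.1 A).trans ?_
    have hinj : Set.InjOn Arc.edge (D.filter fun a => a.Covers A : Set (Arc V E)) := by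
      intro a ha b hb hab
      simp only [Finset.coe_filter, Set.mem_ofPred_eq, hD] at ha hb
      exact arc_eq_of_covers ha.1.1 hb.1.1 hab ha.2 hb.2
    rw [← Finset.sum_image hinj]
    refine Finset.sum_le_sum_of_subset_of_nonneg (fun e he => ?_) fun e _ _ => (hx.2 e).1
    obtain ⟨a, haD, haA, hae⟩ := exists_arc_of_covers (fun v hv => area_pos_disjoint hf h hv)
      (Finset.mem_filter.1 he).2
    exact Finset.mem_image.2 ⟨a, Finset.mem_filter.2 ⟨(hD a).2 haD, haA⟩, hae⟩

/-- Each edge of `γ(V ∖ R)` has at most two arcs and each edge of `δ(R)` at most one. -/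
theorem sum_arcs_le {w : E → ℝ} (hw : ∀ e, 0 ≤ w e) {D : Finset (Arc V E)}
    (hD : ∀ a, a ∈ D ↔ a ∈ G.areaArcs R) :
    ∑ a ∈ D, w a.edge ≤
      (∑ e ∈ G.cut R, w e) + 2 * ∑ e ∈ G.inside (Finset.univ \ R), w e := by
  classical
  rw [← Finset.sum_filter_add_sum_filter_not D
    (fun a => a.edge ∈ G.inside (Finset.univ \ R)), add_comm]
  have hcut : ∀ a ∈ D.filter fun a => a.edge ∉ G.inside (Finset.univ \ R),
      G.ends a.edge = s(a.tail, a.head) ∧ a.edge ∈ G.cut R ∧ a.head ∈ R := by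
    intro a ha
    obtain ⟨haD, hn⟩ := Finset.mem_filter.1 ha
    exact ⟨((hD a).1 haD).1, ((hD a).1 haD).2.resolve_left hn⟩
  have htail : ∀ a ∈ D.filter fun a => a.edge ∉ G.inside (Finset.univ \ R), a.tail ∉ R := by
    intro a ha
    obtain ⟨h1, h2, h3⟩ := hcut a ha
    simp only [cut, Finset.mem_filter, Finset.mem_univ, true_and, h1] at h2
    obtain ⟨u, hu, v, hv, huv⟩ := h2
    rcases Sym2.eq_iff.1 huv with ⟨-, h⟩ | ⟨h, -⟩
    · exact absurd h3 (h ▸ hv)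
    · exact h ▸ hv
  refine add_le_add ?_ ?_
  · have hinj : Set.InjOn Arc.edge
        (D.filter fun a => a.edge ∉ G.inside (Finset.univ \ R) : Set (Arc V E)) := by
      -- Both arcs leave `V ∖ R`, so they cover the biset with both parts equal to `V ∖ R`.
      intro a ha b hb hab
      rw [Finset.mem_coe] at ha hb
      refine arc_eq_of_covers (A := ⟨Finset.univ \ R, Finset.univ \ R, Finset.Subset.refl _⟩)
        (hcut a ha).1 (hcut b hb).1 hab ?_ ?_
      · exact ⟨by simpa using htail a ha, by simpa using (hcut a ha).2.2⟩
      · exact ⟨by simpa using htail b hb, by simpa using (hcut b hb).2.2⟩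
    rw [← Finset.sum_image hinj]
    refine Finset.sum_le_sum_of_subset_of_nonneg (fun e he => ?_) fun e _ _ => hw e
    obtain ⟨a, ha, rfl⟩ := Finset.mem_image.1 he
    exact (hcut a ha).2.1
  · rw [← Finset.sum_fiberwise_of_maps_to
      (t := G.inside (Finset.univ \ R)) (g := Arc.edge) fun a ha => (Finset.mem_filter.1 ha).2,
      Finset.mul_sum]
    refine Finset.sum_le_sum fun e _ => ?_
    rw [Finset.sum_congr rfl (g := fun _ => w e)
      (fun a ha => by rw [(Finset.mem_filter.1 ha).2]), Finset.sum_const, nsmul_eq_mul]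
    refine mul_le_mul_of_nonneg_right ?_ (hw e)
    obtain ⟨⟨u, v⟩, huv⟩ := Sym2.mk_surjective (G.ends e)
    have hsub : ((D.filter fun a => a.edge ∈ G.inside (Finset.univ \ R)).filter
        fun a => a.edge = e) ⊆ {⟨e, u, v⟩, ⟨e, v, u⟩} := by
      rintro ⟨e', u', v'⟩ ha
      simp only [Finset.mem_filter, hD] at ha
      obtain ⟨⟨h1, -⟩, rfl⟩ := ha
      have h2 : s(u, v) = s(u', v') := huv.trans h1.1
      rcases Sym2.eq_iff.1 h2 with ⟨rfl, rfl⟩ | ⟨rfl, rfl⟩ <;> simp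
    exact_mod_cast (Finset.card_le_card hsub).trans Finset.card_le_two

/-- The underlying edges of a directed cover form a cover. -/
theorem isCover_image [DecidableEq E] {g : Biset V → ℤ} {J : Finset (Arc V E)}
    (hJ : (J : Set (Arc V E)) ⊆ G.areaArcs R) (hc : IsDirectedCover g J) :
    G.IsCover g (J.image Arc.edge) := by
  classical
  intro A
  refine (hc A).trans ?_
  norm_cast
  refine Finset.card_le_card_of_injOn Arc.edge (fun a ha => ?_) fun a ha b hb hab => ?_
  · simp only [Finset.coe_filter, Set.mem_ofPred_eq] at ha
    simp only [bisetCut, Finset.coe_filter, Set.mem_ofPred_eq, Finset.mem_image]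
    exact ⟨⟨a, ha.1, rfl⟩, a.tail, ha.2.1, a.head, ha.2.2, (hJ ha.1).1⟩
  · simp only [Finset.coe_filter, Set.mem_ofPred_eq] at ha hb
    exact arc_eq_of_covers (hJ ha.1).1 (hJ hb.1).1 hab ha.2 hb.2

end UGraph

/-- A fractional directed cover by the arcs of `D` is at least as expensive as some directed
cover contained in `D`. -/
theorem exists_isDirectedCover_le {V E : Type*} [Finite V] [DecidableEq V] {g : Biset V → ℤ}
    (hg : Biset.PositivelyIntersectingSupermodular g) (c : E → ℝ) (D : Finset (Arc V E))
    {y : Arc V E → ℝ} (hy : ∀ a, 0 ≤ y a ∧ y a ≤ 1)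
    (hf : ∀ A, (g A : ℝ) ≤ cutSum id D y A) :
    ∃ K ⊆ D, IsDirectedCover g K ∧ arcCost c K ≤ ∑ a ∈ D, c a.edge * y a := by
  classical
  have hmem : (fun i : D => y i) ∈ coverPolytope (fun i : D => (i : Arc V E)) g := by
    refine ⟨fun i => hy i, fun A => (hf A).trans_eq ?_⟩
    exact (Finset.sum_coe_sort D fun a => if a.Covers A then y a else 0).symm
  obtain ⟨w, hw, hw01, hcost⟩ := exists_integral_mem_coverPolytope hg (fun i : D => c i.1.edge)
    hmem
  refine ⟨(Finset.univ.filter fun i : D => w i = 1).map (Function.Embedding.subtype _),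
    fun a ha => ?_, fun A => ?_, ?_⟩
  · obtain ⟨i, -, rfl⟩ := Finset.mem_map.1 ha
    exact i.2
  · have h := hw.2 A
    have hcard : cutSum (fun i : D => (i : Arc V E)) Finset.univ w A
        = (((Finset.univ.filter fun i : D => w i = 1).filter
            fun i : D => (i : Arc V E).Covers A).card : ℝ) := by
      rw [Finset.filter_filter, Finset.card_filter, Nat.cast_sum]
      refine Finset.sum_congr rfl fun i _ => ?_
      rcases hw01 i with h | h <;> simp [h]
    rw [hcard] at h
    rw [Finset.filter_map, Finset.card_map]
    exact_mod_cast h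
  · refine le_trans (le_of_eq ?_) (hcost.trans_eq
      (Finset.sum_coe_sort D fun a => c a.edge * y a))
    rw [arcCost, Finset.sum_map, Finset.sum_filter]
    refine Finset.sum_congr rfl fun i _ => ?_
    rcases hw01 i with h | h <;> simp [h]

theorem lemmal {V E : Type*} [Fintype V] [DecidableEq V] [Fintype E] [DecidableEq E]
    (G : UGraph V E) (c : E → ℝ) (hc : ∀ e, 0 ≤ c e)
    (f : Biset V → ℤ) (hf : 0 ≤ Biset.maxValue f) (R : Finset V)
    (hR : Biset.PositivelyIntersectingSupermodular (Biset.area f R))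
    (x : E → ℝ) (hx : G.BisetLPFeasible (Biset.area f R) x) :
    (∃ I : Finset E, G.IsAreaCoverOutput c f R I) ∧
      ∀ I : Finset E, G.IsAreaCoverOutput c f R I →
        G.IsCover (Biset.area f R) I ∧
          ∑ e ∈ I, c e ≤
            (∑ e ∈ G.cut R, c e * x e) + 2 * (∑ e ∈ G.inside (Finset.univ \ R), c e * x e) := by
  classical
  let D : Finset (Arc V E) := (Set.toFinite (G.areaArcs R)).toFinset
  have hD : ∀ a, a ∈ D ↔ a ∈ G.areaArcs R := fun a => by simp [D]
  obtain ⟨K, hKD, hK, hKc⟩ := exists_isDirectedCover_le hR c D (y := fun a => x a.edge)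
    (fun a => hx.2 a.edge) fun A =>
      (UGraph.area_le_sum_arcs hf hx hD A).trans_eq (Finset.sum_filter _ _)
  refine ⟨?_, ?_⟩
  · obtain ⟨J, hJ, hmin⟩ := Finset.exists_min_image
      (D.powerset.filter fun J => IsDirectedCover (Biset.area f R) J) (arcCost c)
      ⟨K, Finset.mem_filter.2 ⟨Finset.mem_powerset.2 hKD, hK⟩⟩
    obtain ⟨hJD, hJc⟩ := Finset.mem_filter.1 hJ
    refine ⟨J.image Arc.edge, J, ⟨⟨fun a ha => (hD a).1 (Finset.mem_powerset.1 hJD ha), hJc⟩,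
      fun K hK hKc => hmin K (Finset.mem_filter.2 ⟨Finset.mem_powerset.2 fun a ha =>
        (hD a).2 (hK ha), hKc⟩)⟩, rfl⟩
  · rintro I ⟨J, ⟨⟨hJD, hJc⟩, hmin⟩, rfl⟩
    refine ⟨UGraph.isCover_image hJD hJc, ?_⟩
    calc ∑ e ∈ J.image Arc.edge, c e
        ≤ arcCost c J := Finset.sum_image_le_of_nonneg fun _ _ => hc _
      _ ≤ arcCost c K := hmin K (fun a ha => (hD a).1 (hKD ha)) hK
      _ ≤ ∑ a ∈ D, c a.edge * x a.edge := hKc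
      _ ≤ _ := UGraph.sum_arcs_le (w := fun e => c e * x e)
          (fun e => mul_nonneg (hc e) (hx.2 e).1) hD
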